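/- For a prime $p$, let $\sigma$ be the $p\times p$ cyclic shift matrix over $\mathrm{GF}(2)$. For integers $a(0),\dots,a(4)\ge 0$, let $H_{p,a(i)\cdot j}^{5,p}$ be the $5p\times p^2$ parity-check matrix made of the $p\times p$ blocks $\sigma^{a(i)\cdot j}$, $0\le i\le 4$, $0\le j\le p-1$. The code with $a(i)=i$ is the elementary array-based (EAB) code; for pairwise distinct $a(i)\in\{0,\dots,p-1\}$ the code is the selected-row (SR) code with row-selection function $a$. In the Tanner graph of such a matrix (rows are check nodes, columns are variable nodes, and ones are edges), an $(s,t)$ absorbing set is a set $S$ of $s$ variable nodes such that exactly $t$ check nodes have an odd number of neighbours in $S$, and each $v\in S$ has strictly fewer neighbouring checks with an odd number of neighbours in $S$ than neighbouring checks with an even number of neighbours in $S$. (1) For each $(s,t)\in\{(4,8),(5,9),(6,8)\}$, the number of $(s,t)$ absorbing sets of the EAB code $H_{p,i\cdot j}^{5,p}$ is $\Theta(p^3)$ as $p\to\infty$ through the primes. (2) There is a row-selection function, that is, there are pairwise distinct integers $a(0),\dots,a(4)\ge 0$ that do not depend on $p$, such that for all sufficiently large primes $p$ the SR code $H_{p,a(i)\cdot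 j}^{5,p}$ has no $(4,8)$, no $(5,9)$ and no $(6,8)$ absorbing sets. -/

import Mathlib

open Filter Asymptotics

/-- The `p × p` cyclic shift matrix over `GF(2)` (ones on the first subdiagonal and in the upper
right corner), the circulant permutation matrix from which the codes are built. -/
def shiftMatrix (p : ℕ) : Matrix (Fin p) (Fin p) (ZMod 2) :=
  Matrix.of fun l k => if (l : ℕ) = ((k : ℕ) + 1) % p then 1 else 0

/-- The parity-check matrix of the circulant-based code with `r` row groups and `c` column groups
of `p × p` blocks, the block in position `(i, j)` being the `f i j`-th power of the cyclic shift.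
The check node `(i, l)` is the row `l` of row group `i`, the variable node `(j, k)` is the
column `k` of column group `j`. -/
def circulantCode (p : ℕ) {r c : ℕ} (f : Fin r → Fin c → ℕ) :
    Matrix (Fin r × Fin p) (Fin c × Fin p) (ZMod 2) :=
  Matrix.of fun x y => (shiftMatrix p ^ f x.1 y.1) x.2 y.2

/-- The separable circulant-based (SCB) code: the exponent is `f(i,j) = a(i) * b(j)`. -/
def scbCode (p : ℕ) {r c : ℕ} (a : Fin r → ℕ) (b : Fin c → ℕ) :
    Matrix (Fin r × Fin p) (Fin c × Fin p) (ZMod 2) :=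
  circulantCode p fun i j => a i * b j

/-- The selected-row (SR) SCB code with row-selection function `a`: all `p` column groups are
kept, and the exponent is `f(i,j) = a(i) * j`. -/
def srCode (p : ℕ) {r : ℕ} (a : Fin r → ℕ) :
    Matrix (Fin r × Fin p) (Fin p × Fin p) (ZMod 2) :=
  scbCode p a fun j => (j : ℕ)

/-- The elementary array-based (EAB) code with `r` row groups: `f(i,j) = i * j`. -/
def eabCode (p r : ℕ) : Matrix (Fin r × Fin p) (Fin p × Fin p) (ZMod 2) :=
  srCode p fun i : Fin r => (i : ℕ)

section AbsorbingSets

variable {F V : Type*} [Fintype F] [DecidableEq F]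

/-- The degree of the check node `c` in the subgraph of the Tanner graph of `H` that is spanned by
the set `S` of variable nodes and their neighbours. -/
def checkDegree (H : Matrix F V (ZMod 2)) (S : Finset V) (c : F) : ℕ :=
  (S.filter fun v => H c v ≠ 0).card

/-- The neighbouring checks of `S` of odd degree (unsatisfied checks). -/
def oddChecks (H : Matrix F V (ZMod 2)) (S : Finset V) : Finset F :=
  Finset.univ.filter fun c => Odd (checkDegree H S c)

/-- The neighbouring checks of `S` of even degree (satisfied checks). -/
def evenChecks (H : Matrix F V (ZMod 2)) (S : Finset V) : Finset F :=
  Finset.univ.filter fun c => 0 < checkDegree H S c ∧ Even (checkDegree H S c)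

/-- `S` is (the set of variable nodes of) an `(a, b)` absorbing set of the Tanner graph of `H`. -/
structure IsAbsorbingSet (H : Matrix F V (ZMod 2)) (a b : ℕ) (S : Finset V) : Prop where
  card_eq : S.card = a
  card_odd : (oddChecks H S).card = b
  absorbing : ∀ v ∈ S, ((oddChecks H S).filter fun c => H c v ≠ 0).card <
    ((evenChecks H S).filter fun c => H c v ≠ 0).card

/-- The number of `(a, b)` absorbing sets of the Tanner graph of `H`. -/
noncomputable def numAbsorbingSets (H : Matrix F V (ZMod 2)) (a b : ℕ) : ℕ :=
  {S : Finset V | IsAbsorbingSet H a b S}.ncard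

end AbsorbingSets

/-- The filter "`p` is a prime and `p → ∞`". -/
def primesAtTop : Filter ℕ := atTop ⊓ Filter.principal {p : ℕ | p.Prime}

section Lines

/-! ### Absorbing sets as point-line configurations. -/

variable {V L : Type*} [DecidableEq L]

/-- The number of points of `S` on the line of direction `i` with label `l`, where `f i v` is the
label of the line of direction `i` through the point `v`. -/
def lineCount (f : Fin 5 → V → L) (S : Finset V) (i : Fin 5) (l : L) : ℕ :=
  (S.filter fun w => f i w = l).card

/-- The lines that contain an odd number of points of `S`. -/
def oddLines (f : Fin 5 → V → L) (S : Finset V) : Finset (Fin 5 × L) :=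
  ((Finset.univ ×ˢ S).image fun x => (x.1, f x.1 x.2)).filter
    fun l => Odd (lineCount f S l.1 l.2)

/-- The absorbing sets of a Tanner graph whose check nodes are lines in five directions, with
every point on one line of each direction. -/
structure IsAbsorbingConfig (f : Fin 5 → V → L) (s t : ℕ) (S : Finset V) : Prop where
  card_eq : S.card = s
  card_odd : (oddLines f S).card = t
  three_le : ∀ v ∈ S, 3 ≤ (Finset.univ.filter fun i => Even (lineCount f S i (f i v))).card

/-- Two points lie on at most one common line. -/
def IsPartialLinear (f : Fin 5 → V → L) : Prop :=
  ∀ x y, x ≠ y → ∀ i i', f i x = f i y → f i' x = f i' y → i = i'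

/-- A wheel with hub `c` and rim `v`: the spoke to `v k` has direction `i k`, and the rim edge from
`v k` to `v (k + 1)` has direction `j k`. -/
structure IsWheel (f : Fin 5 → V → L) (S : Finset V) (n : ℕ) [NeZero n] (c : V) (v : Fin n → V)
    (i j : Fin n → Fin 5) : Prop where
  hub_mem : c ∈ S
  rim_mem : ∀ k, v k ∈ S
  rim_ne_hub : ∀ k, v k ≠ c
  spoke : ∀ k, f (i k) (v k) = f (i k) c
  rim : ∀ k, f (j k) (v k) = f (j k) (v (k + 1))
  spoke_injective : Function.Injective i
  rim_ne_spoke : ∀ k, j k ≠ i k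
  rim_ne_spoke_succ : ∀ k, j k ≠ i (k + 1)
  rim_ne_rim : ∀ k, j k ≠ j (k + 1)

/-- `S` contains a wheel with three or four spokes. -/
def HasWheel (f : Fin 5 → V → L) (S : Finset V) : Prop :=
  (∃ c v i j, IsWheel f S 3 c v i j) ∨ (∃ c v i j, IsWheel f S 4 c v i j)

variable {f : Fin 5 → V → L} {S : Finset V}

theorem lineCount_pos {v : V} (hv : v ∈ S) (i : Fin 5) : 0 < lineCount f S i (f i v) :=
  Finset.card_pos.2 ⟨v, by simp [hv]⟩

theorem exists_mem_of_lineCount_pos {i : Fin 5} {l : L} (h : 0 < lineCount f S i l) :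
    ∃ v ∈ S, f i v = l := by
  obtain ⟨v, hv⟩ := Finset.card_pos.1 h
  exact ⟨v, by simpa using hv⟩

theorem mem_oddLines {l : Fin 5 × L} : l ∈ oddLines f S ↔ Odd (lineCount f S l.1 l.2) := by
  simp only [oddLines, Finset.mem_filter, and_iff_right_iff_imp, Finset.mem_image]
  intro h
  obtain ⟨v, hv, hl⟩ := exists_mem_of_lineCount_pos h.pos
  exact ⟨(l.1, v), by simp [hv], by simp [hl]⟩

/-- Each variable node has exactly five checks, so fewer odd than even ones means at least three
even ones. Positivity of the degree is automatic at checks adjacent to a point of `S`. -/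
theorem isAbsorbingSet_iff_config [Fintype L] {H : Matrix (Fin 5 × L) V (ZMod 2)}
    (hH : ∀ i l v, H (i, l) v ≠ 0 ↔ f i v = l) {s t : ℕ} :
    IsAbsorbingSet H s t S ↔ IsAbsorbingConfig f s t S := by
  have hdeg : ∀ c : Fin 5 × L, checkDegree H S c = lineCount f S c.1 c.2 := by
    rintro ⟨i, l⟩
    simp [checkDegree, lineCount, hH]
  have hodd : oddChecks H S = oddLines f S := by
    ext c
    simp [oddChecks, mem_oddLines, hdeg]
  have hcard : ∀ (P : Finset (Fin 5 × L)) (v : V), (P.filter fun c => H c v ≠ 0).card =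
      (Finset.univ.filter fun i => (i, f i v) ∈ P).card := by
    intro P v
    symm
    apply Finset.card_bij (fun i _ => (i, f i v))
    · intro i hi
      simpa [hH] using hi
    · intro i _ i' _ h
      exact (Prod.ext_iff.1 h).1
    · rintro ⟨i, l⟩ h
      simp only [Finset.mem_filter, hH] at h
      exact ⟨i, by simpa [h.2] using h.1, by simp [h.2]⟩
  have habs : ∀ v ∈ S, (((oddChecks H S).filter fun c => H c v ≠ 0).card <
      ((evenChecks H S).filter fun c => H c v ≠ 0).card ↔
      3 ≤ (Finset.univ.filter fun i => Even (lineCount f S i (f i v))).card) := by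
    intro v hv
    rw [hcard, hcard]
    have h1 : (Finset.univ.filter fun i => (i, f i v) ∈ evenChecks H S) =
        Finset.univ.filter fun i => Even (lineCount f S i (f i v)) := by
      ext i
      simp [evenChecks, hdeg, lineCount_pos hv]
    have h2 : (Finset.univ.filter fun i => (i, f i v) ∈ oddChecks H S) =
        Finset.univ.filter fun i => ¬ Even (lineCount f S i (f i v)) := by
      ext i
      simp [oddChecks, hdeg]
    rw [h1, h2]
    have := Finset.card_filter_add_card_filter_not (s := (Finset.univ : Finset (Fin 5)))
      (fun i => Even (lineCount f S i (f i v)))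
    rw [Finset.card_univ, Fintype.card_fin] at this
    omega
  constructor
  · rintro ⟨h1, h2, h3⟩
    exact ⟨h1, hodd ▸ h2, fun v hv => (habs v hv).1 (h3 v hv)⟩
  · rintro ⟨h1, h2, h3⟩
    exact ⟨h1, hodd ▸ h2, fun v hv => (habs v hv).2 (h3 v hv)⟩

/-- A map of points that preserves and reflects collinearity carries absorbing sets to absorbing
sets. -/
theorem IsAbsorbingConfig.image {V' L' : Type*} [DecidableEq V'] [DecidableEq L']
    {g : Fin 5 → V' → L'} {s t : ℕ} (h : IsAbsorbingConfig f s t S) (φ : V → V')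
    (hφ : Set.InjOn φ S)
    (hline : ∀ u ∈ S, ∀ w ∈ S, ∀ i, g i (φ u) = g i (φ w) ↔ f i u = f i w) :
    IsAbsorbingConfig g s t (S.image φ) := by
  have hcount : ∀ u ∈ S, ∀ i, lineCount g (S.image φ) i (g i (φ u)) = lineCount f S i (f i u) := by
    intro u hu i
    unfold lineCount
    rw [Finset.filter_image, Finset.card_image_of_injOn]
    · congr 1
      apply Finset.filter_congr
      intro w hw
      exact hline w hw u hu i
    · exact hφ.mono fun w hw => (Finset.mem_filter.1 hw).1
  refine ⟨by rw [Finset.card_image_of_injOn hφ, h.card_eq], ?_, ?_⟩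
  · rw [← h.card_odd]
    symm
    -- A representative point on each odd line transports the line; by `hline` the image does not
    -- depend on the choice.
    choose r hr hr' using fun (l : Fin 5 × L) (hl : l ∈ oddLines f S) =>
      exists_mem_of_lineCount_pos (mem_oddLines.1 hl).pos
    apply Finset.card_bij (fun l hl => (l.1, g l.1 (φ (r l hl))))
    · intro l hl
      rw [mem_oddLines]
      dsimp only
      rw [hcount _ (hr l hl), hr' l hl]
      exact mem_oddLines.1 hl
    · intro l hl m hm e
      obtain ⟨e1, e2⟩ := Prod.ext_iff.1 e
      dsimp only at e1 e2
      rw [← e1, hline _ (hr l hl) _ (hr m hm), hr' l hl, e1, hr' m hm] at e2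
      exact Prod.ext e1 e2
    · rintro ⟨i, l'⟩ hl
      have hl' := mem_oddLines.1 hl
      obtain ⟨v', hv', e⟩ := exists_mem_of_lineCount_pos hl'.pos
      obtain ⟨u, hu, rfl⟩ := Finset.mem_image.1 hv'
      dsimp only at e hl'
      subst e
      rw [hcount u hu] at hl'
      have hm : (i, f i u) ∈ oddLines f S := mem_oddLines.2 hl'
      refine ⟨(i, f i u), hm, Prod.ext rfl ?_⟩
      exact (hline _ (hr _ hm) _ hu i).2 (hr' _ hm)
  · intro v' hv'
    obtain ⟨u, hu, rfl⟩ := Finset.mem_image.1 hv'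
    simpa only [hcount u hu] using h.three_le u hu

end Lines

/-! ### Wheels in dense graphs on at most six vertices. -/

section SmallGraphs

/-- The predicate `p` holds on all lists of `k` Booleans with at most `m` entries `false`. -/
def allBoolLists : ℕ → ℕ → (List Bool → Bool) → Bool
  | 0, _, p => p []
  | k + 1, 0, p => allBoolLists k 0 fun l => p (true :: l)
  | k + 1, m + 1, p => allBoolLists k (m + 1) (fun l => p (true :: l)) &&
      allBoolLists k m fun l => p (false :: l)

theorem allBoolLists_apply {k m : ℕ} {p : List Bool → Bool} (h : allBoolLists k m p = true)
    (l : List Bool) (hl : l.length = k) (hm : l.count false ≤ m) : p l = true := by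
  induction k generalizing p l m with
  | zero => rw [List.length_eq_zero_iff.1 hl]; simpa [allBoolLists] using h
  | succ k ih =>
    obtain ⟨b, l, rfl⟩ := List.exists_cons_of_length_eq_add_one hl
    have hl' : l.length = k := by simpa using hl
    cases m <;> cases b <;> simp [allBoolLists] at h hm
    · exact ih h l hl' (by simp [hm])
    · exact ih h.2 l hl' hm
    · exact ih h.1 l hl' hm

/-- The entry of a list at a given place, `false` beyond its end. -/
def entryOf : List Bool → ℕ → Bool
  | [], _ => false
  | b :: _, 0 => b
  | _ :: l, k + 1 => entryOf l k

/-- The adjacency of the graph whose upper triangle is read off columnwise from `l`. -/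
def triangleAdj (l : List Bool) (a b : ℕ) : Bool :=
  bif Nat.blt a b then entryOf l (Nat.add (Nat.div (Nat.mul b (Nat.pred b)) 2) a)
  else bif Nat.blt b a then entryOf l (Nat.add (Nat.div (Nat.mul a (Nat.pred a)) 2) b) else false

/-- The graph `R` on the vertices `vs` contains a wheel with three or four spokes. -/
def hasWheelGraph (vs : List ℕ) (R : ℕ → ℕ → Bool) : Bool :=
  vs.any fun c => vs.any fun x => R c x &&
    vs.any fun y => R c y && (R x y &&
      vs.any fun z => R c z && (R y z && (R z x ||
        (!Nat.beq x z && vs.any fun w => !Nat.beq w y &&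
          (R c w && (R z w && R w x))))))

/-- Exhaustive kernel check. The allowance of four missing edges out of 15 is what the tangent count
leaves for (6, 8) sets; likewise two out of 10 and none out of 6 below. -/
theorem hasWheelGraph_six (l : List Bool) (hl : l.length = 15) (h : l.count false ≤ 4) :
    hasWheelGraph (List.range 6) (triangleAdj l) = true :=
  allBoolLists_apply (p := fun l => hasWheelGraph [0,1,2,3,4,5] (triangleAdj l))
    (m := 4) (by decide +kernel) l hl h

theorem hasWheelGraph_five (l : List Bool) (hl : l.length = 10) (h : l.count false ≤ 2) :
    hasWheelGraph (List.range 5) (triangleAdj l) = true :=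
  allBoolLists_apply (p := fun l => hasWheelGraph [0,1,2,3,4] (triangleAdj l))
    (m := 2) (by decide +kernel) l hl h

theorem hasWheelGraph_four (l : List Bool) (hl : l.length = 6) (h : l.count false ≤ 0) :
    hasWheelGraph (List.range 4) (triangleAdj l) = true :=
  allBoolLists_apply (p := fun l => hasWheelGraph [0,1,2,3] (triangleAdj l))
    (m := 0) (by decide +kernel) l hl h

theorem triangleAdj_ne {l : List Bool} {a b : ℕ} (h : triangleAdj l a b = true) : a ≠ b := by
  rintro rfl
  simp [triangleAdj, Nat.blt] at h

theorem hasWheelGraph_spec {vs : List ℕ} {R : ℕ → ℕ → Bool} (h : hasWheelGraph vs R = true) :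
    ∃ c ∈ vs, ∃ x ∈ vs, ∃ y ∈ vs, ∃ z ∈ vs, R c x = true ∧ R c y = true ∧ R x y = true ∧
      R c z = true ∧ R y z = true ∧ (R z x = true ∨
        x ≠ z ∧ ∃ w ∈ vs, w ≠ y ∧ R c w = true ∧ R z w = true ∧ R w x = true) := by
  simp only [hasWheelGraph, List.any_eq_true, Bool.and_eq_true, Bool.or_eq_true,
    Bool.not_eq_true'] at h
  obtain ⟨c, hc, x, hx, hcx, y, hy, hcy, hxy, z, hz, hcz, hyz, h⟩ := h
  refine ⟨c, hc, x, hx, y, hy, z, hz, hcx, hcy, hxy, hcz, hyz, ?_⟩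
  rcases h with h | ⟨h, w, hw, h1, h2, h3, h4⟩
  · exact .inl h
  · exact .inr ⟨Nat.ne_of_beq_eq_false h, w, hw, Nat.ne_of_beq_eq_false h1, h2, h3, h4⟩

end SmallGraphs

/-! ### Joined points, and wheels from graphs of joined points. -/

section Lines

variable {V L : Type*} {f : Fin 5 → V → L} {S : Finset V}

/-- A point other than `v` shares at most one line with `v`, so different directions need different
witnesses. -/
theorem IsPartialLinear.card_le (hf : IsPartialLinear f) {v : V} {I : Finset (Fin 5)}
    {W : Finset V} (h : ∀ i ∈ I, ∃ w ∈ W, w ≠ v ∧ f i w = f i v) : I.card ≤ W.card := by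
  refine Finset.card_le_card_of_forall_subsingleton (fun i w => w ≠ v ∧ f i w = f i v)
    (fun i hi => h i hi) ?_
  rintro w - i ⟨-, hne, hi⟩ i' ⟨-, -, hi'⟩
  exact hf w v hne i i' hi hi'

/-- If `I` has as many directions as `W` has points, then `v` is joined to all of `W`. -/
theorem IsPartialLinear.exists_joined (hf : IsPartialLinear f) {v : V} {I : Finset (Fin 5)}
    {W : Finset V} (h : ∀ i ∈ I, ∃ w ∈ W, w ≠ v ∧ f i w = f i v) (hc : W.card ≤ I.card)
    {w : V} (hw : w ∈ W) : ∃ i, f i w = f i v := by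
  classical
  by_contra! hcon
  -- If `w` were not joined to `v`, all directions would find their witness in `W` without `w`,
  -- which is too small.
  have := hf.card_le (I := I) (W := W.erase w) fun i hi => by
    obtain ⟨w', hw', h1, h2⟩ := h i hi
    exact ⟨w', Finset.mem_erase.2 ⟨fun e => hcon i (e ▸ h2), hw'⟩, h1, h2⟩
  have := Finset.card_erase_lt_of_mem hw
  omega

/-- If `I` has as many directions as `W` has points, then different points of `W` lie on different
lines through `v`. -/
theorem IsPartialLinear.joined_unique (hf : IsPartialLinear f) {v : V} {I : Finset (Fin 5)}
    {W : Finset V} (h : ∀ i ∈ I, ∃ w ∈ W, w ≠ v ∧ f i w = f i v) (hc : W.card ≤ I.card)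
    (hv : v ∉ W) {w w' : V} (hw : w ∈ W) (hw' : w' ∈ W) {i : Fin 5} (h1 : f i w = f i v)
    (h2 : f i w' = f i v) : w = w' := by
  classical
  by_contra hne
  have hwv : w ≠ v := fun e => hv (e ▸ hw)
  have hwv' : w' ≠ v := fun e => hv (e ▸ hw')
  -- If `w` and `w'` share a line through `v`, then `w` can replace `w'` as witness, and again one
  -- point is superfluous.
  have := hf.card_le (I := I) (W := W.erase w') fun j hj => by
    obtain ⟨x, hx, h3, h4⟩ := h j hj
    by_cases hxw : x = w'
    · subst hxw
      have : j = i := hf x v h3 j i h4 h2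
      subst this
      exact ⟨w, Finset.mem_erase.2 ⟨hne, hw⟩, hwv, h1⟩
    · exact ⟨x, Finset.mem_erase.2 ⟨hxw, hx⟩, h3, h4⟩
  have := Finset.card_erase_lt_of_mem hw'
  omega

/-- Any coincidence among directions forbidden in a wheel would put three of its points on a common
line, against `hhub` or `hturn`. -/
theorem exists_isWheel {n : ℕ} [NeZero n] {c : V} {v : Fin n → V} (hc : c ∈ S)
    (hv : ∀ k, v k ∈ S) (hne : ∀ k, v k ≠ c) (hspoke : ∀ k, ∃ i, f i (v k) = f i c)
    (hrim : ∀ k, ∃ i, f i (v k) = f i (v (k + 1))) (hn : ∀ k : Fin n, k + 1 ≠ k)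
    (hhub : ∀ k l, k ≠ l → ∀ i, f i (v k) = f i c → f i (v l) ≠ f i c)
    (hturn : ∀ k i, f i (v k) = f i (v (k + 1)) → f i (v (k + 1)) ≠ f i (v (k + 1 + 1))) :
    ∃ i j, IsWheel f S n c v i j := by
  choose i hi using hspoke
  choose j hj using hrim
  refine ⟨i, j, hc, hv, hne, hi, hj, ?_, ?_, ?_, ?_⟩
  · intro k l h
    by_contra hkl
    exact hhub k l hkl (i k) (hi k) (h ▸ hi l)
  · intro k h
    exact hhub k (k + 1) (hn k).symm (i k) (hi k) (by rw [← hi k, ← h, hj k])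
  · intro k h
    exact hhub (k + 1) k (hn k) (i (k + 1)) (hi (k + 1)) (by rw [← hi (k + 1), ← h, hj k])
  · intro k h
    exact hturn k (j k) (hj k) (by rw [h]; exact hj (k + 1))

variable [DecidableEq L]

theorem exists_ne_of_two_le_lineCount {v : V} {i : Fin 5} (h : 2 ≤ lineCount f S i (f i v)) :
    ∃ w ∈ S, w ≠ v ∧ f i w = f i v := by
  classical
  obtain ⟨w, hw, hwv⟩ := Finset.exists_mem_ne (show 1 < _ from h) v
  rw [Finset.mem_filter] at hw
  exact ⟨w, hw.1, hwv, hw.2⟩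

theorem two_le_lineCount_of_even {v : V} (hv : v ∈ S) {i : Fin 5}
    (h : Even (lineCount f S i (f i v))) : 2 ≤ lineCount f S i (f i v) := by
  have := lineCount_pos (f := f) hv i
  obtain ⟨k, hk⟩ := h
  omega

theorem two_le_lineCount {v w : V} (hv : v ∈ S) (hw : w ∈ S) (hne : w ≠ v) {i : Fin 5}
    (h : f i w = f i v) : 2 ≤ lineCount f S i (f i v) :=
  Finset.one_lt_card.2 ⟨v, by simp [hv], w, by simp [hw, h], hne.symm⟩

theorem not_collinear_of_lineCount_le (hthin : ∀ v ∈ S, ∀ i, lineCount f S i (f i v) ≤ 2)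
    {x y z : V} (hx : x ∈ S) (hy : y ∈ S) (hz : z ∈ S) {i : Fin 5} (h1 : f i x = f i z)
    (h2 : f i y = f i z) (hxy : x ≠ y) (hxz : x ≠ z) (hyz : y ≠ z) : False := by
  have := hthin z hz i
  have : 2 < lineCount f S i (f i z) :=
    Finset.two_lt_card.2 ⟨x, by simp [hx, h1], y, by simp [hy, h2], z, by simp [hz], hxy, hxz, hyz⟩
  omega

theorem hasWheel_of_graph (hthin : ∀ v ∈ S, ∀ i, lineCount f S i (f i v) ≤ 2) {vs : List ℕ}
    {l : List Bool} (h : hasWheelGraph vs (triangleAdj l) = true) (P : ℕ → V)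
    (hPS : ∀ a ∈ vs, P a ∈ S) (hP : ∀ a ∈ vs, ∀ b ∈ vs, a ≠ b → P a ≠ P b)
    (hl : ∀ a ∈ vs, ∀ b ∈ vs, triangleAdj l a b = true → ∃ i, f i (P a) = f i (P b)) :
    HasWheel f S := by
  have key : ∀ a ∈ vs, ∀ b ∈ vs, ∀ c ∈ vs, a ≠ b → a ≠ c → b ≠ c → ∀ i, f i (P a) = f i (P c) →
      f i (P b) ≠ f i (P c) := fun a ha b hb c hc hab hac hbc i h1 h2 =>
    not_collinear_of_lineCount_le hthin (hPS a ha) (hPS b hb) (hPS c hc) h1 h2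
      (hP a ha b hb hab) (hP a ha c hc hac) (hP b hb c hc hbc)
  obtain ⟨c, hc, x, hx, y, hy, z, hz, hcx, hcy, hxy, hcz, hyz, h⟩ := hasWheelGraph_spec h
  have ncx := triangleAdj_ne hcx
  have ncy := triangleAdj_ne hcy
  have ncz := triangleAdj_ne hcz
  have nxy := triangleAdj_ne hxy
  have nyz := triangleAdj_ne hyz
  have sy : ∀ a ∈ vs, ∀ b ∈ vs, triangleAdj l a b = true → ∃ i, f i (P b) = f i (P a) :=
    fun a ha b hb h => (hl a ha b hb h).imp fun _ => Eq.symm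
  rcases h with hzx | ⟨nxz, w, hw, nwy, hcw, hzw, hwx⟩
  · have nzx := triangleAdj_ne hzx
    left
    refine ⟨P c, ![P x, P y, P z], exists_isWheel (hPS c hc) ?_ ?_ ?_ ?_ ?_ ?_ ?_⟩
    · simp [Fin.forall_fin_succ, *]
    · simp [Fin.forall_fin_succ]
      exact ⟨hP _ hx _ hc ncx.symm, hP _ hy _ hc ncy.symm, hP _ hz _ hc ncz.symm⟩
    · simp only [Fin.forall_fin_succ]
      exact ⟨sy _ hc _ hx hcx, sy _ hc _ hy hcy, sy _ hc _ hz hcz, by simp⟩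
    · simp only [Fin.forall_fin_succ]
      exact ⟨hl _ hx _ hy hxy, hl _ hy _ hz hyz, hl _ hz _ hx hzx, by simp⟩
    · decide
    · intro k l hkl i
      fin_cases k <;> fin_cases l <;> first | exact absurd rfl hkl | skip
      all_goals apply key <;> first | assumption | (symm; assumption)
    · intro k i h1 h2
      revert h1 h2
      fin_cases k <;> intro h1 h2
      · exact key z hz x hx y hy nzx nyz.symm nxy i h2.symm h1
      · exact key x hx y hy z hz nxy nzx.symm nyz i h2.symm h1
      · exact key y hy z hz x hx nyz nxy.symm nzx i h2.symm h1
  · have ncw := triangleAdj_ne hcw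
    have nzw := triangleAdj_ne hzw
    have nwx := triangleAdj_ne hwx
    right
    refine ⟨P c, ![P x, P y, P z, P w], exists_isWheel (hPS c hc) ?_ ?_ ?_ ?_ ?_ ?_ ?_⟩
    · simp [Fin.forall_fin_succ, *]
    · simp [Fin.forall_fin_succ]
      exact ⟨hP _ hx _ hc ncx.symm, hP _ hy _ hc ncy.symm, hP _ hz _ hc ncz.symm,
        hP _ hw _ hc ncw.symm⟩
    · simp only [Fin.forall_fin_succ]
      exact ⟨sy _ hc _ hx hcx, sy _ hc _ hy hcy, sy _ hc _ hz hcz, sy _ hc _ hw hcw, by simp⟩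
    · simp only [Fin.forall_fin_succ]
      exact ⟨hl _ hx _ hy hxy, hl _ hy _ hz hyz, hl _ hz _ hw hzw, hl _ hw _ hx hwx, by simp⟩
    · decide
    · intro k l hkl i
      fin_cases k <;> fin_cases l <;> first | exact absurd rfl hkl | skip
      all_goals apply key <;> first | assumption | (symm; assumption)
    · intro k i h1 h2
      revert h1 h2
      fin_cases k <;> intro h1 h2
      · exact key z hz x hx y hy nxz.symm nyz.symm nxy i h2.symm h1
      · exact key w hw y hy z hz nwy nzw.symm nyz i h2.symm h1
      · exact key x hx z hz w hw nxz nwx.symm nzw i h2.symm h1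
      · exact key y hy w hw x hx nwy.symm nxy.symm nwx i h2.symm h1

end Lines

/-! ### Sets without three points on a line. -/

section Lines

variable {V L : Type*} [DecidableEq L] {f : Fin 5 → V → L} {S : Finset V}

/-- The directions of the lines through `v` that contain no other point of `S`. -/
def tangents (f : Fin 5 → V → L) (S : Finset V) (v : V) : Finset (Fin 5) :=
  Finset.univ.filter fun i => lineCount f S i (f i v) = 1

/-- The directions of the lines through `v` that contain another point of `S`. -/
def secants (f : Fin 5 → V → L) (S : Finset V) (v : V) : Finset (Fin 5) :=
  Finset.univ.filter fun i => 2 ≤ lineCount f S i (f i v)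

theorem card_tangents_add_card_secants {v : V} (hv : v ∈ S) :
    (tangents f S v).card + (secants f S v).card = 5 := by
  have h : secants f S v = Finset.univ.filter fun i => ¬ lineCount f S i (f i v) = 1 := by
    refine Finset.filter_congr fun i _ => ?_
    have := lineCount_pos (f := f) hv i
    omega
  rw [h, tangents, Finset.card_filter_add_card_filter_not]
  rfl

/-- A tangent meets `S` in one point, hence is an odd line counted for that point only. -/
theorem sum_card_tangents_le : ∑ v ∈ S, (tangents f S v).card ≤ (oddLines f S).card := by
  rw [← Finset.card_sigma]
  apply Finset.card_le_card_of_injOn (fun x => (x.2, f x.2 x.1))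
  · rintro ⟨v, i⟩ h
    simp only [Finset.coe_sigma, Set.mem_sigma_iff, Finset.mem_coe, tangents, Finset.mem_filter]
      at h
    rw [Finset.mem_coe, mem_oddLines]
    dsimp only
    rw [h.2.2]
    exact odd_one
  · rintro ⟨v, i⟩ h ⟨w, i'⟩ h' e
    simp only [Finset.coe_sigma, Set.mem_sigma_iff, Finset.mem_coe, tangents, Finset.mem_filter]
      at h h'
    obtain ⟨e1, e2⟩ := Prod.ext_iff.1 e
    dsimp only at e1 e2
    subst e1
    have : v = w := by
      by_contra hne
      have := two_le_lineCount h'.1 h.1 hne e2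
      omega
    subst this
    rfl

theorem card_secants_le_card_joined
    (hf : IsPartialLinear f) (v : V) [DecidablePred fun w => w ≠ v ∧ ∃ i, f i w = f i v] :
    (secants f S v).card ≤ (S.filter fun w => w ≠ v ∧ ∃ i, f i w = f i v).card := by
  apply hf.card_le (v := v)
  intro i hi
  obtain ⟨w, hw, hne, h⟩ := exists_ne_of_two_le_lineCount (Finset.mem_filter.1 hi).2
  exact ⟨w, Finset.mem_filter.2 ⟨hw, hne, i, h⟩, hne, h⟩

theorem exists_enumeration {n : ℕ} (hn : 0 < n) (hS : S.card = n) :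
    ∃ P : ℕ → V, Set.InjOn P (Finset.range n) ∧ (Finset.range n : Set ℕ).image P = S := by
  obtain ⟨e⟩ : Nonempty (Fin n ≃ S) := ⟨(S.equivFinOfCardEq hS).symm⟩
  have : NeZero n := ⟨hn.ne'⟩
  refine ⟨fun k => e (Fin.ofNat n k), ?_, ?_⟩
  · intro a ha b hb h
    have h1 := congrArg Fin.val (e.injective (Subtype.ext h))
    simp only [Fin.ofNat, Finset.coe_range, Set.mem_Iio] at h1 ha hb
    rwa [Nat.mod_eq_of_lt ha, Nat.mod_eq_of_lt hb] at h1
  · ext v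
    constructor
    · rintro ⟨k, -, rfl⟩
      exact (e _).2
    · intro hv
      refine ⟨e.symm ⟨v, hv⟩, by simp, ?_⟩
      simp

theorem ite_beq_false_eq_toNat (b : Bool) : (if (b == false) = true then 1 else 0) = (!b).toNat := by
  cases b <;> rfl

theorem toNat_not_add_toNat (b : Bool) : (!b).toNat + b.toNat = 1 := by
  cases b <;> rfl

/-- The sum counts every edge twice. The thresholds 12, 16 and 22 here and below are 5s - t for the
three types (s, t). -/
theorem exists_hasWheelGraph_four {J : ℕ → ℕ → Bool} (hJ : ∀ a b, J b a = J a b)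
    (h : 12 ≤ ∑ a ∈ Finset.range 4, ∑ b ∈ Finset.range 4, (decide (a ≠ b) && J b a).toNat) :
    ∃ l, hasWheelGraph (List.range 4) (triangleAdj l) = true ∧
      ∀ a ∈ List.range 4, ∀ b ∈ List.range 4, triangleAdj l a b = true → J a b = true := by
  refine ⟨[J 0 1, J 0 2, J 1 2, J 0 3, J 1 3, J 2 3], hasWheelGraph_four _ rfl ?_, ?_⟩
  · simp only [Finset.sum_range_succ, Finset.sum_range_zero] at h
    simp [hJ 0 1, hJ 0 2, hJ 1 2, hJ 0 3, hJ 1 3, hJ 2 3] at h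
    simp only [List.count_cons, List.count_nil, ite_beq_false_eq_toNat]
    have h01 := toNat_not_add_toNat (J 0 1)
    have h02 := toNat_not_add_toNat (J 0 2)
    have h12 := toNat_not_add_toNat (J 1 2)
    have h03 := toNat_not_add_toNat (J 0 3)
    have h13 := toNat_not_add_toNat (J 1 3)
    have h23 := toNat_not_add_toNat (J 2 3)
    omega
  · intro a ha b hb
    rw [List.mem_range] at ha hb
    interval_cases a <;> interval_cases b <;> intro h <;>
      first | exact h | exact (hJ _ _).trans h | exact absurd h Bool.false_ne_true

theorem exists_hasWheelGraph_five {J : ℕ → ℕ → Bool} (hJ : ∀ a b, J b a = J a b)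
    (h : 16 ≤ ∑ a ∈ Finset.range 5, ∑ b ∈ Finset.range 5, (decide (a ≠ b) && J b a).toNat) :
    ∃ l, hasWheelGraph (List.range 5) (triangleAdj l) = true ∧
      ∀ a ∈ List.range 5, ∀ b ∈ List.range 5, triangleAdj l a b = true → J a b = true := by
  refine ⟨[J 0 1, J 0 2, J 1 2, J 0 3, J 1 3, J 2 3, J 0 4, J 1 4, J 2 4, J 3 4], hasWheelGraph_five _ rfl ?_, ?_⟩
  · simp only [Finset.sum_range_succ, Finset.sum_range_zero] at h
    simp [hJ 0 1, hJ 0 2, hJ 1 2, hJ 0 3, hJ 1 3, hJ 2 3, hJ 0 4, hJ 1 4, hJ 2 4, hJ 3 4] at h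
    simp only [List.count_cons, List.count_nil, ite_beq_false_eq_toNat]
    have h01 := toNat_not_add_toNat (J 0 1)
    have h02 := toNat_not_add_toNat (J 0 2)
    have h12 := toNat_not_add_toNat (J 1 2)
    have h03 := toNat_not_add_toNat (J 0 3)
    have h13 := toNat_not_add_toNat (J 1 3)
    have h23 := toNat_not_add_toNat (J 2 3)
    have h04 := toNat_not_add_toNat (J 0 4)
    have h14 := toNat_not_add_toNat (J 1 4)
    have h24 := toNat_not_add_toNat (J 2 4)
    have h34 := toNat_not_add_toNat (J 3 4)
    omega
  · intro a ha b hb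
    rw [List.mem_range] at ha hb
    interval_cases a <;> interval_cases b <;> intro h <;>
      first | exact h | exact (hJ _ _).trans h | exact absurd h Bool.false_ne_true

theorem exists_hasWheelGraph_six {J : ℕ → ℕ → Bool} (hJ : ∀ a b, J b a = J a b)
    (h : 22 ≤ ∑ a ∈ Finset.range 6, ∑ b ∈ Finset.range 6, (decide (a ≠ b) && J b a).toNat) :
    ∃ l, hasWheelGraph (List.range 6) (triangleAdj l) = true ∧
      ∀ a ∈ List.range 6, ∀ b ∈ List.range 6, triangleAdj l a b = true → J a b = true := by
  refine ⟨[J 0 1, J 0 2, J 1 2, J 0 3, J 1 3, J 2 3, J 0 4, J 1 4, J 2 4, J 3 4,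
    J 0 5, J 1 5, J 2 5, J 3 5, J 4 5], hasWheelGraph_six _ rfl ?_, ?_⟩
  · simp only [Finset.sum_range_succ, Finset.sum_range_zero] at h
    simp [hJ 0 1, hJ 0 2, hJ 1 2, hJ 0 3, hJ 1 3, hJ 2 3, hJ 0 4, hJ 1 4, hJ 2 4, hJ 3 4, hJ 0 5, hJ 1 5, hJ 2 5, hJ 3 5, hJ 4 5] at h
    simp only [List.count_cons, List.count_nil, ite_beq_false_eq_toNat]
    have h01 := toNat_not_add_toNat (J 0 1)
    have h02 := toNat_not_add_toNat (J 0 2)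
    have h12 := toNat_not_add_toNat (J 1 2)
    have h03 := toNat_not_add_toNat (J 0 3)
    have h13 := toNat_not_add_toNat (J 1 3)
    have h23 := toNat_not_add_toNat (J 2 3)
    have h04 := toNat_not_add_toNat (J 0 4)
    have h14 := toNat_not_add_toNat (J 1 4)
    have h24 := toNat_not_add_toNat (J 2 4)
    have h34 := toNat_not_add_toNat (J 3 4)
    have h05 := toNat_not_add_toNat (J 0 5)
    have h15 := toNat_not_add_toNat (J 1 5)
    have h25 := toNat_not_add_toNat (J 2 5)
    have h35 := toNat_not_add_toNat (J 3 5)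
    have h45 := toNat_not_add_toNat (J 4 5)
    omega
  · intro a ha b hb
    rw [List.mem_range] at ha hb
    interval_cases a <;> interval_cases b <;> intro h <;>
      first | exact h | exact (hJ _ _).trans h | exact absurd h Bool.false_ne_true

/-- Each point has five lines, tangent or secant. At most t incidences are tangent, and different
secants through a point lead to different points, so there are at least 5s - t ordered joined pairs.
-/
theorem hasWheel_of_thin (hf : IsPartialLinear f)
    (hthin : ∀ v ∈ S, ∀ i, lineCount f S i (f i v) ≤ 2)
    (hcard : S.card = 4 ∧ (oddLines f S).card = 8 ∨ S.card = 5 ∧ (oddLines f S).card = 9 ∨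
      S.card = 6 ∧ (oddLines f S).card = 8) : HasWheel f S := by
  classical
  have hn : 0 < S.card := by omega
  obtain ⟨P, hinj, himg⟩ := exists_enumeration hn rfl
  have hSP : S = (Finset.range S.card).image P := by
    rw [← Finset.coe_inj, Finset.coe_image, himg]
  have hsum : 5 * S.card ≤ (oddLines f S).card + ∑ a ∈ Finset.range S.card,
      ∑ b ∈ Finset.range S.card, (decide (a ≠ b ∧ ∃ i, f i (P b) = f i (P a))).toNat := by
    calc 5 * S.card = ∑ v ∈ S, ((tangents f S v).card + (secants f S v).card) := by
          rw [Finset.sum_congr rfl fun v hv => card_tangents_add_card_secants hv]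
          simp [mul_comm]
      _ ≤ (oddLines f S).card + ∑ v ∈ S, (secants f S v).card := by
          rw [Finset.sum_add_distrib]
          exact Nat.add_le_add_right sum_card_tangents_le _
      _ ≤ (oddLines f S).card +
          ∑ v ∈ S, (S.filter fun w => w ≠ v ∧ ∃ i, f i w = f i v).card :=
          Nat.add_le_add_left (Finset.sum_le_sum fun v _ =>
            card_secants_le_card_joined hf v) _
      _ = _ := by
          congr 1
          nth_rewrite 1 [hSP]
          rw [Finset.sum_image hinj]
          refine Finset.sum_congr rfl fun a ha => ?_
          rw [Finset.card_filter]
          nth_rewrite 1 [hSP]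
          rw [Finset.sum_image hinj]
          refine Finset.sum_congr rfl fun b hb => ?_
          rw [← Bool.cond_decide]
          have : (P b ≠ P a ∧ ∃ i, f i (P b) = f i (P a)) ↔
              (a ≠ b ∧ ∃ i, f i (P b) = f i (P a)) := by
            rw [ne_comm, hinj.ne_iff ha hb]
          simp only [this]
          cases decide (a ≠ b ∧ ∃ i, f i (P b) = f i (P a)) <;> rfl
  have hPS : ∀ a < S.card, P a ∈ S := fun a ha => by
    rw [← Finset.mem_coe, ← himg]
    exact ⟨a, by simpa using ha, rfl⟩
  have hPne : ∀ a < S.card, ∀ b < S.card, a ≠ b → P a ≠ P b := fun a ha b hb h =>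
    (hinj.ne_iff (by simpa using ha) (by simpa using hb)).2 h
  have hsymm : ∀ a b, decide (∃ i, f i (P b) = f i (P a)) = decide (∃ i, f i (P a) = f i (P b)) :=
    fun a b => by simp only [eq_comm]
  set J : ℕ → ℕ → Bool := fun a b => decide (∃ i, f i (P a) = f i (P b)) with hJ
  have hJ' : ∀ a b, J a b = true → ∃ i, f i (P a) = f i (P b) := fun a b h => by simpa [hJ] using h
  have hJs : ∀ a b, J b a = J a b := hsymm
  have hsum' : 5 * S.card ≤ (oddLines f S).card + ∑ a ∈ Finset.range S.card,
      ∑ b ∈ Finset.range S.card, (decide (a ≠ b) && J b a).toNat := by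
    simpa only [Bool.decide_and] using hsum
  clear_value J
  obtain ⟨l, hl, hlJ⟩ : ∃ l, hasWheelGraph (List.range S.card) (triangleAdj l) = true ∧
      ∀ a ∈ List.range S.card, ∀ b ∈ List.range S.card, triangleAdj l a b = true →
        J a b = true := by
    rcases hcard with ⟨h1, h2⟩ | ⟨h1, h2⟩ | ⟨h1, h2⟩ <;> rw [h1, h2] at hsum' <;> rw [h1]
    · exact exists_hasWheelGraph_four hJs (by omega)
    · exact exists_hasWheelGraph_five hJs (by omega)
    · exact exists_hasWheelGraph_six hJs (by omega)
  simp only [List.mem_range] at hlJ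
  exact hasWheel_of_graph hthin hl P (by simpa using hPS) (by simpa using hPne)
    fun a ha b hb h => hJ' a b (hlJ a (List.mem_range.1 ha) b (List.mem_range.1 hb) h)

end Lines

/-! ### Sets with three or more points on a line. -/

section Lines

variable {V L : Type*} {f : Fin 5 → V → L} {S : Finset V}

/-- If every point off a line is joined to every point on it by a different line, and two points
off the line are joined, then there is a complete quadrilateral. -/
theorem hasWheel_of_joined_off_line (hf : IsPartialLinear f) {i₀ : Fin 5} {l : L} {v v' u u' : V}
    (hv : v ∈ S) (hv' : v' ∈ S) (hu : u ∈ S) (hu' : u' ∈ S) (hl : f i₀ v = l) (hl' : f i₀ v' = l)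
    (hul : f i₀ u ≠ l) (hul' : f i₀ u' ≠ l) (hvv : v ≠ v') (huu : u ≠ u')
    (hjoin : ∀ x ∈ S, f i₀ x = l → ∀ y ∈ S, f i₀ y ≠ l → ∃ i, f i y = f i x)
    (huniq : ∀ x ∈ S, f i₀ x = l → ∀ y ∈ S, f i₀ y ≠ l → ∀ y' ∈ S, f i₀ y' ≠ l → ∀ i,
      f i y = f i x → f i y' = f i x → y = y')
    (hj : ∃ i, f i u = f i u') : HasWheel f S := by
  have hline : ∀ i, f i v = f i v' → i = i₀ := fun i h =>
    hf v v' hvv i i₀ h (hl.trans hl'.symm)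
  have h1 : ∀ i, f i u = f i v → f i u' = f i v → False := fun i h h' =>
    huu (huniq v hv hl u hu hul u' hu' hul' i h h')
  have h2 : ∀ i, f i u = f i v' → f i u' = f i v' → False := fun i h h' =>
    huu (huniq v' hv' hl' u hu hul u' hu' hul' i h h')
  have h3 : ∀ i, f i v' = f i v → f i u = f i v → False := fun i h h' => by
    have := hline i h.symm
    subst this
    exact hul (h'.trans hl)
  have h4 : ∀ i, f i v' = f i v → f i u' = f i v → False := fun i h h' => by
    have := hline i h.symm
    subst this
    exact hul' (h'.trans hl)
  have hne : ∀ {x y}, f i₀ x = l → f i₀ y ≠ l → y ≠ x := fun hx hy e => hy (e ▸ hx)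
  left
  refine ⟨v, ![v', u, u'], exists_isWheel hv ?_ ?_ ?_ ?_ (by decide) ?_ ?_⟩
  · simp [Fin.forall_fin_succ, *]
  · simp [Fin.forall_fin_succ]
    exact ⟨hvv.symm, hne hl hul, hne hl hul'⟩
  · simp only [Fin.forall_fin_succ]
    exact ⟨⟨i₀, hl'.trans hl.symm⟩, hjoin v hv hl u hu hul, hjoin v hv hl u' hu' hul', by simp⟩
  · simp only [Fin.forall_fin_succ]
    exact ⟨(hjoin v' hv' hl' u hu hul).imp fun _ => Eq.symm, hj,
      hjoin v' hv' hl' u' hu' hul', by simp⟩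
  · intro k m hkm i
    fin_cases k <;> fin_cases m <;> first | exact absurd rfl hkm | skip
    · exact h3 i
    · exact h4 i
    · exact fun a b => h3 i b a
    · exact h1 i
    · exact fun a b => h4 i b a
    · exact fun a b => h1 i b a
  · intro k i a b
    revert a b
    fin_cases k <;> intro a b
    · exact h2 i a.symm (b.symm.trans a.symm)
    · exact h2 i (a.trans b) b
    · exact h2 i b.symm (a.trans rfl)

variable [DecidableEq L]

theorem hasWheel_of_thick (hf : IsPartialLinear f) {s t : ℕ} (hS : IsAbsorbingConfig f s t S)
    (hs : s ≤ 6) (ht : t ≤ 8 ∨ s ≤ 5) {v₀ : V} (hv₀ : v₀ ∈ S) {i₀ : Fin 5}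
    (hthick : 3 ≤ lineCount f S i₀ (f i₀ v₀)) : HasWheel f S := by
  classical
  set l := f i₀ v₀ with hl
  set T := S.filter fun w => f i₀ w = l with hT
  set U := S.filter fun w => ¬ f i₀ w = l with hU
  have hTU : T.card + U.card = s := by
    rw [← hS.card_eq]
    exact Finset.card_filter_add_card_filter_not _
  have hT3 : 3 ≤ T.card := hthick
  have hmemT : ∀ {x}, x ∈ T ↔ x ∈ S ∧ f i₀ x = l := Finset.mem_filter
  have hmemU : ∀ {x}, x ∈ U ↔ x ∈ S ∧ f i₀ x ≠ l := Finset.mem_filter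
  have hsec : ∀ v ∈ T, ∀ i ∈ (secants f S v).erase i₀, ∃ w ∈ U, w ≠ v ∧ f i w = f i v := by
    intro v hv i hi
    obtain ⟨hne, hi⟩ := Finset.mem_erase.1 hi
    obtain ⟨w, hw, hwv, h⟩ := exists_ne_of_two_le_lineCount (Finset.mem_filter.1 hi).2
    refine ⟨w, hmemU.2 ⟨hw, fun h' => hne ?_⟩, hwv, h⟩
    exact hf w v hwv i i₀ h (h'.trans (hmemT.1 hv).2.symm)
  set E : V → Finset (Fin 5) := fun v =>
    (Finset.univ.filter fun i => Even (lineCount f S i (f i v))).erase i₀ with hE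
  have hEsec : ∀ v ∈ T, ∀ i ∈ E v, ∃ w ∈ U, w ≠ v ∧ f i w = f i v := by
    intro v hv i hi
    obtain ⟨hne, hi⟩ := Finset.mem_erase.1 hi
    exact hsec v hv i (Finset.mem_erase.2 ⟨hne, Finset.mem_filter.2 ⟨Finset.mem_univ _,
      two_le_lineCount_of_even (hmemT.1 hv).1 (Finset.mem_filter.1 hi).2⟩⟩)
  have hE2 : ∀ v ∈ T, 2 ≤ (E v).card ∧ (Odd T.card → 3 ≤ (E v).card) := by
    intro v hv
    have h3 := hS.three_le v (hmemT.1 hv).1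
    constructor
    · have := Finset.pred_card_le_card_erase (a := i₀)
        (s := Finset.univ.filter fun i => Even (lineCount f S i (f i v)))
      simp only [hE]
      omega
    · intro hodd
      simp only [hE]
      -- When `T` has odd size, `i₀` is not an even direction, so removing it costs nothing.
      rw [Finset.erase_eq_of_notMem]
      · exact h3
      · simp only [Finset.mem_filter, Finset.mem_univ, true_and, Nat.not_even_iff_odd]
        rw [(hmemT.1 hv).2]
        exact hodd
  have hv₀T : v₀ ∈ T := hmemT.2 ⟨hv₀, rfl⟩
  have hU2 := (hE2 v₀ hv₀T).1.trans (hf.card_le (hEsec v₀ hv₀T))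
  have hU3 := fun h => ((hE2 v₀ hv₀T).2 h).trans (hf.card_le (hEsec v₀ hv₀T))
  -- Two points off the line are needed, and three if `T` has odd size; with at most six points only
  -- these splits survive.
  have hcases : s = 6 ∧ (T.card = 4 ∧ U.card = 2 ∨ T.card = 3 ∧ U.card = 3) := by
    by_cases h3 : T.card = 3
    · have := hU3 (by rw [h3]; decide)
      omega
    · omega
  have hUE : ∀ v ∈ T, U.card ≤ (E v).card := by
    intro v hv
    rcases hcases.2 with ⟨-, h⟩ | ⟨h', h⟩
    · rw [h]
      exact (hE2 v hv).1
    · rw [h]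
      exact (hE2 v hv).2 (by rw [h']; decide)
  by_cases hj : ∃ u ∈ U, ∃ u' ∈ U, u ≠ u' ∧ ∃ i, f i u = f i u'
  · obtain ⟨u, hu, u', hu', huu, hj⟩ := hj
    obtain ⟨v, hv, v', hv', hvv⟩ := Finset.one_lt_card.1 (show 1 < T.card by omega)
    rw [hmemU] at hu hu'
    rw [hmemT] at hv hv'
    refine hasWheel_of_joined_off_line hf hv.1 hv'.1 hu.1 hu'.1 hv.2 hv'.2 hu.2 hu'.2 hvv huu
      ?_ ?_ hj
    · intro x hx hxl y hy hyl
      have hxT := hmemT.2 ⟨hx, hxl⟩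
      exact hf.exists_joined (hEsec x hxT) (hUE x hxT) (hmemU.2 ⟨hy, hyl⟩)
    · intro x hx hxl y hy hyl y' hy' hyl' i h h'
      have hxT := hmemT.2 ⟨hx, hxl⟩
      exact hf.joined_unique (hEsec x hxT) (hUE x hxT) (fun h => (hmemU.1 h).2 hxl)
        (hmemU.2 ⟨hy, hyl⟩) (hmemU.2 ⟨hy', hyl'⟩) h h'
  -- With no joined pair off the line there are at least 4·2 + 2·1 = 10 or 3·1 + 3·2 = 9 tangents,
  -- more than the 8 odd lines.
  · exfalso
    have htT : ∀ v ∈ T, 4 - U.card ≤ (tangents f S v).card := by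
      intro v hv
      have h1 := card_tangents_add_card_secants (f := f) (hmemT.1 hv).1
      have h2 := hf.card_le (hsec v hv)
      have h3 := Finset.pred_card_le_card_erase (a := i₀) (s := secants f S v)
      omega
    have htU : ∀ u ∈ U, 5 - T.card ≤ (tangents f S u).card := by
      intro u hu
      have h1 := card_tangents_add_card_secants (f := f) (hmemU.1 hu).1
      have h2 := hf.card_le (v := u) (I := secants f S u) (W := T) fun i hi => by
        obtain ⟨w, hw, hwu, h⟩ := exists_ne_of_two_le_lineCount (Finset.mem_filter.1 hi).2
        refine ⟨w, hmemT.2 ⟨hw, ?_⟩, hwu, h⟩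
        by_contra hwl
        exact hj ⟨w, hmemU.2 ⟨hw, hwl⟩, u, hu, hwu, i, h⟩
      omega
    have h1 := sum_card_tangents_le (f := f) (S := S)
    rw [hS.card_odd, ← Finset.sum_filter_add_sum_filter_not S fun w => f i₀ w = l] at h1
    have h2 := Finset.card_nsmul_le_sum T _ _ htT
    have h3 := Finset.card_nsmul_le_sum U _ _ htU
    change ∑ v ∈ T, _ + ∑ v ∈ U, _ ≤ _ at h1
    rcases hcases.2 with ⟨hT4, hU2⟩ | ⟨hT4, hU2⟩ <;> rw [hT4, hU2] at h2 h3 <;>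
      simp only [smul_eq_mul] at h2 h3 <;> omega

/-- Every `(4, 8)`, `(5, 9)` or `(6, 8)` absorbing set contains a wheel. -/
theorem IsAbsorbingConfig.hasWheel (hf : IsPartialLinear f) {ab : ℕ × ℕ}
    (hab : ab ∈ ({(4, 8), (5, 9), (6, 8)} : Set (ℕ × ℕ)))
    (hS : IsAbsorbingConfig f ab.1 ab.2 S) : HasWheel f S := by
  have hcard : S.card = 4 ∧ (oddLines f S).card = 8 ∨ S.card = 5 ∧ (oddLines f S).card = 9 ∨
      S.card = 6 ∧ (oddLines f S).card = 8 := by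
    rw [hS.card_eq, hS.card_odd]
    simpa [Prod.ext_iff] using hab
  by_cases hthin : ∀ v ∈ S, ∀ i, lineCount f S i (f i v) ≤ 2
  · exact hasWheel_of_thin hf hthin hcard
  · push Not at hthin
    obtain ⟨v, hv, i, h⟩ := hthin
    rw [hS.card_eq, hS.card_odd] at hcard
    exact hasWheel_of_thick hf hS (by omega) (by omega) hv h

end Lines

/-! ### Generation by two points and the upper bound. -/

section Closure

variable {V L : Type*} [DecidableEq V] [DecidableEq L] [Fintype V] {f : Fin 5 → V → L}
  {S : Finset V}

/-- The set `A` together with the intersections of lines through points of `A`. -/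
def lineClosure (f : Fin 5 → V → L) (A : Finset V) : Finset V :=
  A ∪ Finset.univ.filter fun x => ∃ a ∈ A, ∃ b ∈ A, ∃ i i', i ≠ i' ∧ f i x = f i a ∧
    f i' x = f i' b

theorem self_subset_lineClosure (A : Finset V) : A ⊆ lineClosure f A :=
  Finset.subset_union_left

theorem mem_lineClosure {A : Finset V} {x a b : V} (ha : a ∈ A) (hb : b ∈ A) {i i' : Fin 5}
    (h : i ≠ i') (h1 : f i x = f i a) (h2 : f i' x = f i' b) : x ∈ lineClosure f A :=
  Finset.mem_union_right _ (Finset.mem_filter.2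
    ⟨Finset.mem_univ _, a, ha, b, hb, i, i', h, h1, h2⟩)

/-- A bound for the size of the closure of a set of `n` points. -/
def closureBound (n : ℕ) : ℕ := n + n * n * 25

/-- An added point is determined by two points of `A` and two different directions, whence the
n·n·25. -/
theorem IsPartialLinear.card_lineClosure_le (hf : IsPartialLinear f) {A : Finset V} {n : ℕ}
    (hA : A.card ≤ n) : (lineClosure f A).card ≤ closureBound n := by
  refine (Finset.card_union_le _ _).trans (Nat.add_le_add hA ?_)
  have : ((A ×ˢ A) ×ˢ (Finset.univ : Finset (Fin 5 × Fin 5))).card ≤ n * n * 25 := by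
    rw [Finset.card_product, Finset.card_product, Finset.card_univ]
    exact Nat.mul_le_mul (Nat.mul_le_mul hA hA) (by simp)
  refine le_trans (Finset.card_le_card_of_forall_subsingleton
    (fun x (y : (V × V) × Fin 5 × Fin 5) => y.2.1 ≠ y.2.2 ∧ f y.2.1 x = f y.2.1 y.1.1 ∧
      f y.2.2 x = f y.2.2 y.1.2) ?_ ?_) this
  · intro x hx
    obtain ⟨-, a, ha, b, hb, i, i', h⟩ := Finset.mem_filter.1 hx
    exact ⟨((a, b), (i, i')), by simp [ha, hb], h⟩
  · rintro ⟨⟨a, b⟩, i, i'⟩ - x ⟨-, hne, h1, h2⟩ y ⟨-, -, h3, h4⟩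
    by_contra hxy
    exact hne (hf x y hxy i i' (h1.trans h3.symm) (h2.trans h4.symm))

/-- A set of at most six points in which every point has three even lines is generated by any
four of its points that lie in the closure of a smaller set. -/
theorem IsAbsorbingConfig.subset_lineClosure {s t : ℕ} (hS : IsAbsorbingConfig f s t S)
    (hf : IsPartialLinear f) (hs : s ≤ 6) {A B : Finset V} (hBS : B ⊆ S) (hBA : B ⊆ A)
    (hB : 4 ≤ B.card) : S ⊆ lineClosure f A := by
  intro v hv
  by_cases hvB : v ∈ B
  · exact self_subset_lineClosure A (hBA hvB)
  set E := Finset.univ.filter fun i => Even (lineCount f S i (f i v)) with hE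
  have hEw : ∀ i ∈ E, ∃ w ∈ S, w ≠ v ∧ f i w = f i v := fun i hi =>
    exists_ne_of_two_le_lineCount (two_le_lineCount_of_even hv (Finset.mem_filter.1 hi).2)
  set I := E.filter fun i => ∃ w ∈ B, f i w = f i v with hI
  have h1 : (E.filter fun i => ¬ ∃ w ∈ B, f i w = f i v).card ≤ ((S \ B).erase v).card := by
    apply hf.card_le (v := v)
    intro i hi
    obtain ⟨hi, h⟩ := Finset.mem_filter.1 hi
    obtain ⟨w, hw, hwv, h'⟩ := hEw i hi
    refine ⟨w, ?_, hwv, h'⟩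
    simp only [Finset.mem_erase, Finset.mem_sdiff]
    exact ⟨hwv, hw, fun hwB => h ⟨w, hwB, h'⟩⟩
  have h2 : ((S \ B).erase v).card + 1 = (S \ B).card :=
    Finset.card_erase_add_one (Finset.mem_sdiff.2 ⟨hv, hvB⟩)
  have h3 : (S \ B).card + B.card = S.card := Finset.card_sdiff_add_card_eq_card hBS
  have h4 : I.card + (E.filter fun i => ¬ ∃ w ∈ B, f i w = f i v).card = E.card :=
    Finset.card_filter_add_card_filter_not _
  have h5 : 3 ≤ E.card := hS.three_le v hv
  have h6 := hS.card_eq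
  -- At most one point besides `v` lies outside `B`, so of three even lines through `v` at least two
  -- meet `B`.
  obtain ⟨i, hi, i', hi', hne⟩ := Finset.one_lt_card.1 (show 1 < I.card by omega)
  obtain ⟨-, a, ha, hia⟩ := Finset.mem_filter.1 hi
  obtain ⟨-, b, hb, hib⟩ := Finset.mem_filter.1 hi'
  exact mem_lineClosure (hBA ha) (hBA hb) hne hia.symm hib.symm

/-- Both rim neighbours of `v 0` are intersections of a spoke through `c` with a rim edge through `v
0`. -/
theorem IsWheel.exists_four {n : ℕ} [NeZero n] {c : V} {v : Fin n → V} {i j : Fin n → Fin 5}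
    (h : IsWheel f S n c v i j) (hf : IsPartialLinear f) (h01 : (0 : Fin n) ≠ 1)
    (h12 : (1 : Fin n) ≠ -1) (h20 : (-1 : Fin n) ≠ 0) :
    ∃ B ⊆ S, B ⊆ lineClosure f {c, v 0} ∧ 4 ≤ B.card := by
  have hinj : ∀ k l, k ≠ l → v k ≠ v l := fun k l hkl e =>
    hkl (h.spoke_injective (hf (v k) c (h.rim_ne_hub k) _ _ (h.spoke k) (by rw [e, h.spoke l])))
  refine ⟨{c, v 0, v 1, v (-1)}, ?_, ?_, ?_⟩
  · intro x hx
    simp only [Finset.mem_insert, Finset.mem_singleton] at hx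
    rcases hx with rfl | rfl | rfl | rfl
    exacts [h.hub_mem, h.rim_mem _, h.rim_mem _, h.rim_mem _]
  · intro x hx
    have hc : c ∈ ({c, v 0} : Finset V) := by simp
    have hv : v 0 ∈ ({c, v 0} : Finset V) := by simp
    simp only [Finset.mem_insert, Finset.mem_singleton] at hx
    rcases hx with rfl | rfl | rfl | rfl
    · exact self_subset_lineClosure _ hc
    · exact self_subset_lineClosure _ hv
    · have h1 := h.rim 0
      have h2 := h.rim_ne_spoke_succ 0
      rw [zero_add] at h1 h2
      exact mem_lineClosure hv hc h2 h1.symm (h.spoke 1)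
    · have h1 := h.rim (-1)
      rw [neg_add_cancel] at h1
      exact mem_lineClosure hv hc (h.rim_ne_spoke (-1)) h1 (h.spoke (-1))
  · have e1 := (h.rim_ne_hub 0).symm
    have e2 := (h.rim_ne_hub 1).symm
    have e3 := (h.rim_ne_hub (-1)).symm
    have e4 := hinj 0 1 h01
    have e5 := hinj 1 (-1) h12
    have e6 := (hinj (-1) 0 h20).symm
    rw [Finset.card_insert_of_notMem (by simp [*]), Finset.card_insert_of_notMem (by simp [*]),
      Finset.card_insert_of_notMem (by simp [*]), Finset.card_singleton]

theorem IsAbsorbingConfig.exists_generators (hf : IsPartialLinear f) {ab : ℕ × ℕ}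
    (hab : ab ∈ ({(4, 8), (5, 9), (6, 8)} : Set (ℕ × ℕ)))
    (hS : IsAbsorbingConfig f ab.1 ab.2 S) :
    ∃ v w, (∃ i, f i w = f i v) ∧ S ⊆ lineClosure f (lineClosure f {v, w}) := by
  have hs : ab.1 ≤ 6 := by
    rcases hab with rfl | rfl | rfl <;> simp
  rcases hS.hasWheel hf hab with ⟨c, v, i, j, h⟩ | ⟨c, v, i, j, h⟩
  · obtain ⟨B, hBS, hBA, hB⟩ := h.exists_four hf (by decide) (by decide) (by decide)
    exact ⟨c, v 0, ⟨i 0, h.spoke 0⟩, hS.subset_lineClosure hf hs hBS hBA hB⟩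
  · obtain ⟨B, hBS, hBA, hB⟩ := h.exists_four hf (by decide) (by decide) (by decide)
    exact ⟨c, v 0, ⟨i 0, h.spoke 0⟩, hS.subset_lineClosure hf hs hBS hBA hB⟩

theorem ncard_isAbsorbingConfig_le (hf : IsPartialLinear f) {ab : ℕ × ℕ}
    (hab : ab ∈ ({(4, 8), (5, 9), (6, 8)} : Set (ℕ × ℕ))) {m M : ℕ}
    (hM : closureBound (closureBound 2) ≤ M)
    (hm : ∀ v, (Finset.univ.filter fun w => ∃ i, f i w = f i v).card ≤ m) :
    {S | IsAbsorbingConfig f ab.1 ab.2 S}.ncard ≤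
      Fintype.card V * (m * 2 ^ M) := by
  set F : Finset (Finset V) := Finset.univ.biUnion fun v =>
    (Finset.univ.filter fun w => ∃ i, f i w = f i v).biUnion fun w =>
      (lineClosure f (lineClosure f {v, w})).powerset with hF
  have hsub : {S | IsAbsorbingConfig f ab.1 ab.2 S} ⊆ (F : Set (Finset V)) := by
    intro S hS
    obtain ⟨v, w, hvw, h⟩ := IsAbsorbingConfig.exists_generators hf hab hS
    simp only [hF, Finset.coe_biUnion, Set.mem_iUnion, Finset.mem_coe, Finset.mem_powerset]
    exact ⟨v, Finset.mem_univ _, w, Finset.mem_filter.2 ⟨Finset.mem_univ _, hvw⟩, h⟩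
  refine (Set.ncard_le_ncard hsub F.finite_toSet).trans ?_
  rw [Set.ncard_coe_finset]
  refine Finset.card_biUnion_le_card_mul _ _ _ fun v _ => ?_
  refine le_trans (Finset.card_biUnion_le_card_mul _ _ (2 ^ M)
    fun w _ => ?_) (Nat.mul_le_mul_right _ (hm v))
  rw [Finset.card_powerset]
  exact Nat.pow_le_pow_right two_pos
    ((hf.card_lineClosure_le (hf.card_lineClosure_le Finset.card_le_two)).trans hM)

end Closure

/-! ### Array codes as lines over `ZMod p`, and the closing condition. -/

section Codes

theorem shiftMatrix_pow_apply {p : ℕ} (n : ℕ) (l k : Fin p) :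
    (shiftMatrix p ^ n) l k = if (l : ℕ) = ((k : ℕ) + n) % p then 1 else 0 := by
  induction n generalizing k with
  | zero =>
    rw [pow_zero, Matrix.one_apply, add_zero, Nat.mod_eq_of_lt k.2]
    simp only [Fin.ext_iff]
  | succ n ih =>
    have hp : 0 < p := k.pos
    rw [pow_succ, Matrix.mul_apply,
      Finset.sum_eq_single (⟨((k : ℕ) + 1) % p, Nat.mod_lt _ hp⟩ : Fin p)]
    · rw [ih, shiftMatrix, Matrix.of_apply]
      simp only [if_true, mul_one, Nat.mod_add_mod]
      rw [add_right_comm, add_assoc (k : ℕ)]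
    · intro m _ hm
      rw [shiftMatrix, Matrix.of_apply, if_neg, mul_zero]
      exact fun h => hm (Fin.ext h)
    · simp

/-- The check node of row group `i` that is adjacent to the variable node `v`. -/
def checkLabel (p : ℕ) [NeZero p] (a : Fin 5 → ℕ) (i : Fin 5) (v : Fin p × Fin p) : Fin p :=
  Fin.ofNat p (v.2 + a i * v.1)

variable {p : ℕ}

theorem srCode_ne_zero_iff [NeZero p] [Fact (1 < p)] (a : Fin 5 → ℕ) (i : Fin 5) (l : Fin p)
    (v : Fin p × Fin p) : srCode p a (i, l) v ≠ 0 ↔ checkLabel p a i v = l := by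
  simp only [srCode, scbCode, circulantCode, Matrix.of_apply, shiftMatrix_pow_apply, ne_eq,
    ite_eq_right_iff, one_ne_zero, imp_false, not_not, checkLabel, Fin.ext_iff, Fin.ofNat]
  exact eq_comm

theorem checkLabel_eq_iff [NeZero p] {a : Fin 5 → ℕ} {i : Fin 5} {v w : Fin p × Fin p} :
    checkLabel p a i v = checkLabel p a i w ↔
      ((v.2 : ℕ) : ZMod p) + a i * (v.1 : ℕ) = (w.2 : ℕ) + a i * (w.1 : ℕ) := by
  rw [checkLabel, checkLabel, Fin.ext_iff, Fin.ofNat, Fin.ofNat, ← ZMod.natCast_eq_natCast_iff']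
  push_cast
  rfl

theorem fin_natCast_zmod_injective : Function.Injective fun x : Fin p => ((x : ℕ) : ZMod p) := by
  intro x y h
  have := (ZMod.natCast_eq_natCast_iff' _ _ _).1 h
  rw [Nat.mod_eq_of_lt x.2, Nat.mod_eq_of_lt y.2] at this
  exact Fin.ext this

theorem natCast_zmod_injective {a : Fin 5 → ℕ} (ha : Function.Injective a) (hap : ∀ i, a i < p) :
    Function.Injective fun i => (a i : ZMod p) := by
  intro i i' h
  have := (ZMod.natCast_eq_natCast_iff' _ _ _).1 h
  rw [Nat.mod_eq_of_lt (hap i), Nat.mod_eq_of_lt (hap i')] at this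
  exact ha this

theorem isPartialLinear_checkLabel [Fact p.Prime] {a : Fin 5 → ℕ} (ha : Function.Injective a)
    (hap : ∀ i, a i < p) : IsPartialLinear (checkLabel p a) := by
  intro x y hxy i i' h h'
  rw [checkLabel_eq_iff] at h h'
  by_contra hii
  have h0 : (a i - a i' : ZMod p) ≠ 0 := sub_ne_zero.2 fun e =>
    hii (natCast_zmod_injective ha hap e)
  have h1 : ((x.1 : ℕ) - (y.1 : ℕ) : ZMod p) = 0 :=
    (mul_eq_zero.1 (show (a i - a i' : ZMod p) * ((x.1 : ℕ) - (y.1 : ℕ)) = 0 by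
      linear_combination h - h')).resolve_left h0
  have h2 : ((x.2 : ℕ) : ZMod p) = (y.2 : ℕ) := by
    linear_combination h - a i * h1
  exact hxy (Prod.ext (fin_natCast_zmod_injective (sub_eq_zero.1 h1))
    (fin_natCast_zmod_injective h2))

/-- The slopes of a wheel satisfy a closing condition. -/
theorem IsWheel.prod_eq [Fact p.Prime] {a : Fin 5 → ℕ} {S : Finset (Fin p × Fin p)} {n : ℕ}
    [NeZero n] {c : Fin p × Fin p} {v : Fin n → Fin p × Fin p} {i j : Fin n → Fin 5}
    (h : IsWheel (checkLabel p a) S n c v i j) :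
    ∏ k, (a (i k) - a (j k) : ZMod p) = ∏ k, (a (i (k + 1)) - a (j k) : ZMod p) := by
  set r : Fin n → ZMod p := fun k => ((v k).1 : ℕ) - (c.1 : ℕ) with hr
  have hs : ∀ k, (((v k).2 : ℕ) : ZMod p) + a (i k) * ((v k).1 : ℕ) =
      (c.2 : ℕ) + a (i k) * (c.1 : ℕ) := fun k => checkLabel_eq_iff.1 (h.spoke k)
  -- On a spoke, equal first coordinates force equal points, so no offset vanishes and the product
  -- can be cancelled.
  have hr0 : ∀ k, r k ≠ 0 := by
    intro k hk
    have h2 : (((v k).2 : ℕ) : ZMod p) = (c.2 : ℕ) := by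
      linear_combination hs k - a (i k) * hk
    exact h.rim_ne_hub k (Prod.ext (fin_natCast_zmod_injective (sub_eq_zero.1 hk))
      (fin_natCast_zmod_injective h2))
  have hrim : ∀ k, r k * (a (i k) - a (j k)) = r (k + 1) * (a (i (k + 1)) - a (j k)) := by
    intro k
    simp only [hr]
    linear_combination hs k - hs (k + 1) - checkLabel_eq_iff.1 (h.rim k)
  have hprod : ∏ k, r (k + 1) = ∏ k, r k := 
    Equiv.prod_comp (Equiv.addRight (1 : Fin n)) r
  have h0 : ∏ k, r k ≠ 0 := Finset.prod_ne_zero_iff.2 fun k _ => hr0 k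
  apply mul_left_cancel₀ h0
  conv_rhs => rw [← hprod]
  rw [← Finset.prod_mul_distrib, ← Finset.prod_mul_distrib]
  exact Finset.prod_congr rfl fun k _ => hrim k

end Codes

/-! ### Slopes for which no wheel closes. -/

section SelectedRows

/-- A row selection for which no wheel closes up. -/
def selectedRows : Fin 5 → ℕ := ![0, 1, 2, 4, 5]

/-- The integer `x` is nonzero and of absolute value at most `1250`. -/
def IsSmallNonzero (x : ℤ) : Prop := x ≠ 0 ∧ x.natAbs ≤ 1250

instance : DecidablePred IsSmallNonzero := fun x =>
  inferInstanceAs (Decidable (x ≠ 0 ∧ x.natAbs ≤ 1250))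

theorem IsSmallNonzero.intCast_ne_zero {x : ℤ} (h : IsSmallNonzero x) {p : ℕ} (hp : 1250 < p) :
    (x : ZMod p) ≠ 0 := by
  rw [Ne, ZMod.intCast_zmod_eq_zero_iff_dvd]
  intro hd
  have := Nat.le_of_dvd (Int.natAbs_pos.2 h.1) (Int.natCast_dvd.1 hd)
  have := h.2
  omega

-- Finite check of the closing condition. All factors have absolute value at most 5, and 1250 =
-- 2·5^4 covers the case of four spokes too. Conditions are interleaved with the quantifiers to
-- prune the search.
set_option synthInstance.maxHeartbeats 400000 in
set_option synthInstance.maxSize 2000 in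
theorem isSmallNonzero_three_spokes : ∀ i₀ i₁ : Fin 5, i₀ ≠ i₁ → ∀ i₂, i₀ ≠ i₂ → i₁ ≠ i₂ →
    ∀ j₀, j₀ ≠ i₀ → j₀ ≠ i₁ → ∀ j₁, j₁ ≠ i₁ → j₁ ≠ i₂ → j₀ ≠ j₁ →
    ∀ j₂, j₂ ≠ i₂ → j₂ ≠ i₀ → j₁ ≠ j₂ → j₂ ≠ j₀ →
    IsSmallNonzero (((selectedRows i₀ - selectedRows j₀ : ℤ) *
      (selectedRows i₁ - selectedRows j₁) * (selectedRows i₂ - selectedRows j₂)) -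
      ((selectedRows i₁ - selectedRows j₀) * (selectedRows i₂ - selectedRows j₁) *
      (selectedRows i₀ - selectedRows j₂))) := by
  decide +kernel

set_option synthInstance.maxHeartbeats 400000 in
set_option synthInstance.maxSize 2000 in
theorem isSmallNonzero_four_spokes : ∀ i₀ i₁ : Fin 5, i₀ ≠ i₁ → ∀ i₂, i₀ ≠ i₂ → i₁ ≠ i₂ →
    ∀ i₃, i₀ ≠ i₃ → i₁ ≠ i₃ → i₂ ≠ i₃ → ∀ j₀, j₀ ≠ i₀ → j₀ ≠ i₁ →
    ∀ j₁, j₁ ≠ i₁ → j₁ ≠ i₂ → j₀ ≠ j₁ → ∀ j₂, j₂ ≠ i₂ → j₂ ≠ i₃ → j₁ ≠ j₂ →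
    ∀ j₃, j₃ ≠ i₃ → j₃ ≠ i₀ → j₂ ≠ j₃ → j₃ ≠ j₀ →
    IsSmallNonzero (((selectedRows i₀ - selectedRows j₀ : ℤ) *
      (selectedRows i₁ - selectedRows j₁) * (selectedRows i₂ - selectedRows j₂) *
      (selectedRows i₃ - selectedRows j₃)) -
      ((selectedRows i₁ - selectedRows j₀) * (selectedRows i₂ - selectedRows j₁) *
      (selectedRows i₃ - selectedRows j₂) * (selectedRows i₀ - selectedRows j₃))) := by
  decide +kernel

theorem not_hasWheel_selectedRows {p : ℕ} [Fact p.Prime] (hp : 1250 < p)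
    (S : Finset (Fin p × Fin p)) : ¬ HasWheel (checkLabel p selectedRows) S := by
  rintro (⟨c, v, i, j, h⟩ | ⟨c, v, i, j, h⟩)
  · have hi : ∀ k l, k ≠ l → i k ≠ i l := fun k l => h.spoke_injective.ne
    have key := (isSmallNonzero_three_spokes _ _ (hi 0 1 (by decide)) _ (hi 0 2 (by decide))
      (hi 1 2 (by decide)) _ (h.rim_ne_spoke 0) (h.rim_ne_spoke_succ 0)
      _ (h.rim_ne_spoke 1) (h.rim_ne_spoke_succ 1) (h.rim_ne_rim 0)
      _ (h.rim_ne_spoke 2) (h.rim_ne_spoke_succ 2) (h.rim_ne_rim 1)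
      (h.rim_ne_rim 2)).intCast_ne_zero hp
    have h1 := h.prod_eq
    rw [Fin.prod_univ_three, Fin.prod_univ_three] at h1
    apply key
    push_cast
    exact sub_eq_zero.2 h1
  · have hi : ∀ k l, k ≠ l → i k ≠ i l := fun k l => h.spoke_injective.ne
    have key := (isSmallNonzero_four_spokes _ _ (hi 0 1 (by decide)) _ (hi 0 2 (by decide))
      (hi 1 2 (by decide)) _ (hi 0 3 (by decide)) (hi 1 3 (by decide)) (hi 2 3 (by decide))
      _ (h.rim_ne_spoke 0) (h.rim_ne_spoke_succ 0)
      _ (h.rim_ne_spoke 1) (h.rim_ne_spoke_succ 1) (h.rim_ne_rim 0)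
      _ (h.rim_ne_spoke 2) (h.rim_ne_spoke_succ 2) (h.rim_ne_rim 1)
      _ (h.rim_ne_spoke 3) (h.rim_ne_spoke_succ 3) (h.rim_ne_rim 2)
      (h.rim_ne_rim 3)).intCast_ne_zero hp
    have h1 := h.prod_eq
    rw [Fin.prod_univ_four, Fin.prod_univ_four] at h1
    apply key
    push_cast
    exact sub_eq_zero.2 h1

end SelectedRows

/-! ### Integral configurations and the lower bound. -/

section Families

/-- The label of the line of direction `i` through a point of the integral plane. -/
def integralLabel (i : Fin 5) (u : ℤ × ℤ) : ℤ := u.2 + (i : ℕ) * u.1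

/-- The element of `Fin p` that represents a residue class. -/
def residue (p : ℕ) [NeZero p] (z : ZMod p) : Fin p := ⟨z.val, z.val_lt⟩

/-- The image of an integral point under scaling by `t` and translation by `(x, y)`. -/
def affinePoint (p : ℕ) [NeZero p] (x y t : ZMod p) (u : ℤ × ℤ) : Fin p × Fin p :=
  (residue p (x + t * u.1), residue p (y + t * u.2))

variable {p : ℕ}

theorem natCast_residue [NeZero p] (z : ZMod p) : ((residue p z : ℕ) : ZMod p) = z :=
  ZMod.natCast_zmod_val z

theorem residue_injective [NeZero p] : Function.Injective (residue p) := fun z w h => by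
  rw [← natCast_residue z, h, natCast_residue]

/-- Label differences are multiplied by the unit `t`, and an integer smaller than p in absolute
value vanishes modulo p only if it is zero. -/
theorem checkLabel_affinePoint_iff [Fact p.Prime] {x y t : ZMod p} (ht : t ≠ 0) {u w : ℤ × ℤ}
    {i : Fin 5} (h : (integralLabel i u - integralLabel i w).natAbs < p) :
    checkLabel p (fun i => (i : ℕ)) i (affinePoint p x y t u) =
      checkLabel p (fun i => (i : ℕ)) i (affinePoint p x y t w) ↔
      integralLabel i u = integralLabel i w := by
  have h1 : integralLabel i u = integralLabel i w ↔
      ((integralLabel i u - integralLabel i w : ℤ) : ZMod p) = 0 := by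
    rw [ZMod.intCast_zmod_eq_zero_iff_dvd, ← sub_eq_zero]
    constructor
    · intro h0
      rw [h0]
      exact dvd_zero _
    · intro hd
      exact Int.eq_zero_of_dvd_of_natAbs_lt_natAbs hd (by simpa using h)
  rw [checkLabel_eq_iff, h1]
  simp only [affinePoint, natCast_residue, integralLabel]
  push_cast
  rw [← mul_eq_zero_iff_left ht, ← sub_eq_zero]
  constructor <;> intro h2 <;> linear_combination h2

theorem IsAbsorbingConfig.affine [Fact p.Prime] {s t : ℕ} {C : Finset (ℤ × ℤ)}
    (hC : IsAbsorbingConfig integralLabel s t C)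
    (hp : ∀ u ∈ C, ∀ w ∈ C, ∀ i, (integralLabel i u - integralLabel i w).natAbs < p)
    {x y r : ZMod p} (hr : r ≠ 0) :
    IsAbsorbingConfig (checkLabel p fun i => (i : ℕ)) s t (C.image (affinePoint p x y r)) := by
  have hl : ∀ u ∈ C, ∀ w ∈ C, ∀ i, checkLabel p (fun i => (i : ℕ)) i (affinePoint p x y r u) =
      checkLabel p (fun i => (i : ℕ)) i (affinePoint p x y r w) ↔
      integralLabel i u = integralLabel i w := fun u hu w hw i =>
    checkLabel_affinePoint_iff hr (hp u hu w hw i)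
  refine hC.image _ ?_ hl
  intro u hu w hw h
  have h0 := (hl u hu w hw 0).1 (by rw [h])
  have h1 := (hl u hu w hw 1).1 (by rw [h])
  simp only [integralLabel, Fin.val_zero, Fin.val_one] at h0 h1
  push_cast at h0 h1
  exact Prod.ext (by linarith) (by linarith)

/-- An integral configuration yields a three-parameter family of absorbing sets. -/
theorem le_ncard_isAbsorbingConfig [Fact p.Prime] {s t : ℕ} {C : Finset (ℤ × ℤ)}
    (hC : IsAbsorbingConfig integralLabel s t C) {b : ℤ} (h0 : (0, 0) ∈ C) (h1 : (1, b) ∈ C)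
    (hp : ∀ u ∈ C, ∀ w ∈ C, ∀ i, (integralLabel i u - integralLabel i w).natAbs < p) :
    p * p * (p - 1) ≤
      s * s * {S | IsAbsorbingConfig (checkLabel p fun i => (i : ℕ)) s t S}.ncard := by
  classical
  set D : Finset ((ZMod p × ZMod p) × ZMod p) := Finset.univ ×ˢ {0}ᶜ with hD
  set Φ : (ZMod p × ZMod p) × ZMod p → Finset (Fin p × Fin p) :=
    fun x => C.image (affinePoint p x.1.1 x.1.2 x.2) with hΦ
  have hΦC : ∀ x ∈ D, IsAbsorbingConfig (checkLabel p fun i => (i : ℕ)) s t (Φ x) := by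
    intro x hx
    exact hC.affine hp (by simpa [hD] using hx)
  have hDcard : D.card = p * p * (p - 1) := by
    rw [hD, Finset.card_product, Finset.card_univ, Fintype.card_prod, Finset.card_compl,
      Finset.card_singleton, ZMod.card]
  have hfib : ∀ S ∈ D.image Φ, (D.filter fun x => Φ x = S).card ≤ s * s := by
    intro S hS
    obtain ⟨x, hx, rfl⟩ := Finset.mem_image.1 hS
    rw [← (hΦC x hx).card_eq, ← Finset.card_product]
    -- The images of (0, 0) and (1, b) lie in the set and determine the translation and the scale.
    refine Finset.card_le_card_of_injOn
      (fun z => (affinePoint p z.1.1 z.1.2 z.2 (0, 0), affinePoint p z.1.1 z.1.2 z.2 (1, b)))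
      ?_ ?_
    · intro z hz
      rw [← (Finset.mem_filter.1 hz).2]
      exact Finset.mem_coe.2 (Finset.mem_product.2
        ⟨Finset.mem_image_of_mem _ h0, Finset.mem_image_of_mem _ h1⟩)
    · rintro ⟨⟨x₁, y₁⟩, t₁⟩ - ⟨⟨x₂, y₂⟩, t₂⟩ - h
      simp only [affinePoint, Prod.mk.injEq, residue_injective.eq_iff] at h
      obtain ⟨⟨hx, hy⟩, ht, -⟩ := h
      push_cast at hx hy ht
      have hx' : x₁ = x₂ := by linear_combination hx
      have hy' : y₁ = y₂ := by linear_combination hy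
      have ht' : t₁ = t₂ := by linear_combination ht - hx
      rw [hx', hy', ht']
  rw [← hDcard]
  refine (Finset.card_le_mul_card_image D (s * s) hfib).trans (Nat.mul_le_mul_left _ ?_)
  rw [← Set.ncard_coe_finset]
  refine Set.ncard_le_ncard ?_ (Set.toFinite _)
  intro S hS
  obtain ⟨x, hx, rfl⟩ := Finset.mem_image.1 (Finset.mem_coe.1 hS)
  exact hΦC x hx

/-- Integral configurations that give absorbing sets of the three types. -/
theorem exists_integral_config {ab : ℕ × ℕ}
    (hab : ab ∈ ({(4, 8), (5, 9), (6, 8)} : Set (ℕ × ℕ))) :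
    ∃ (C : Finset (ℤ × ℤ)) (b : ℤ), IsAbsorbingConfig integralLabel ab.1 ab.2 C ∧ (0, 0) ∈ C ∧
      (1, b) ∈ C ∧
      ∀ u ∈ C, ∀ w ∈ C, ∀ i, (integralLabel i u - integralLabel i w).natAbs < 100 := by
  rcases hab with rfl | rfl | rfl
  · exact ⟨{(0, 0), (1, -2), (2, -2), (-1, 4)}, -2, ⟨by decide +kernel, by decide +kernel,
      by decide +kernel⟩, by decide +kernel, by decide +kernel, by decide +kernel⟩
  · exact ⟨{(0, 0), (1, -3), (2, -4), (3, -3), (-1, 5)}, -3, ⟨by decide +kernel,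
      by decide +kernel, by decide +kernel⟩, by decide +kernel, by decide +kernel,
      by decide +kernel⟩
  · exact ⟨{(0, 0), (1, 2), (2, -2), (0, 4), (-1, 4), (1, -2)}, 2, ⟨by decide +kernel,
      by decide +kernel, by decide +kernel⟩, by decide +kernel, by decide +kernel,
      by decide +kernel⟩

/-- No line is vertical, so a joined point is fixed by its direction from `v` and its first
coordinate. -/
theorem card_joined_checkLabel_le [Fact p.Prime] (a : Fin 5 → ℕ) (v : Fin p × Fin p) :
    (Finset.univ.filter fun w => ∃ i, checkLabel p a i w = checkLabel p a i v).card ≤ 5 * p := by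
  have h5 : (Finset.univ : Finset (Fin 5 × Fin p)).card = 5 * p := by simp
  rw [← h5]
  refine Finset.card_le_card_of_forall_subsingleton
    (fun w y => checkLabel p a y.1 w = checkLabel p a y.1 v ∧ w.1 = y.2) ?_ ?_
  · intro w hw
    obtain ⟨i, hi⟩ := (Finset.mem_filter.1 hw).2
    exact ⟨(i, w.1), Finset.mem_univ _, hi, rfl⟩
  · rintro ⟨i, j⟩ - w ⟨-, hw, hwj⟩ w' ⟨-, hw', hwj'⟩
    dsimp only at hw hw' hwj hwj'
    have h := checkLabel_eq_iff.1 (hw.trans hw'.symm)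
    have hj : w.1 = w'.1 := hwj.trans hwj'.symm
    rw [hj] at h
    exact Prod.ext hj (fin_natCast_zmod_injective (add_right_cancel h))

theorem numAbsorbingSets_srCode [Fact p.Prime] (a : Fin 5 → ℕ) (s t : ℕ) :
    numAbsorbingSets (srCode p a) s t = {S | IsAbsorbingConfig (checkLabel p a) s t S}.ncard := by
  have : Fact (1 < p) := ⟨(Fact.out : p.Prime).one_lt⟩
  simp only [numAbsorbingSets, isAbsorbingSet_iff_config (srCode_ne_zero_iff a)]

end Families

/-! ### Assembly of the asymptotic statements. -/

theorem theorem2 :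
    (∀ ab ∈ ({(4, 8), (5, 9), (6, 8)} : Set (ℕ × ℕ)),
      (fun p : ℕ => (numAbsorbingSets (eabCode p 5) ab.1 ab.2 : ℝ))
        =Θ[primesAtTop] (fun p : ℕ => (p : ℝ) ^ 3)) ∧
    (∃ a : Fin 5 → ℕ, Function.Injective a ∧
      ∀ᶠ p in primesAtTop, (∀ i, a i < p) ∧
        ∀ ab ∈ ({(4, 8), (5, 9), (6, 8)} : Set (ℕ × ℕ)),
          ¬ ∃ S, IsAbsorbingSet (srCode p a) ab.1 ab.2 S) := by
  refine ⟨fun ab hab => ⟨?_, ?_⟩, selectedRows, by decide, ?_⟩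
  -- An opaque `M` keeps the huge power `2 ^ M` from being evaluated.
  · obtain ⟨M, hM⟩ : ∃ M, closureBound (closureBound 2) ≤ M := ⟨_, le_rfl⟩
    refine IsBigO.of_bound (5 * 2 ^ M) (eventually_inf_principal.2 ?_)
    filter_upwards [eventually_ge_atTop 100] with p hp hprime
    have : Fact p.Prime := ⟨hprime⟩
    have h := ncard_isAbsorbingConfig_le (f := checkLabel p fun i => (i : ℕ))
      (isPartialLinear_checkLabel Fin.val_injective fun i => by omega) hab hM
      (card_joined_checkLabel_le _)
    rw [eabCode, numAbsorbingSets_srCode, Real.norm_of_nonneg (by positivity),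
      Real.norm_of_nonneg (by positivity)]
    rw [Fintype.card_prod, Fintype.card_fin] at h
    calc _ ≤ ((p * p * (5 * p * 2 ^ M) : ℕ) : ℝ) := by exact_mod_cast h
      _ = 5 * 2 ^ M * (p : ℝ) ^ 3 := by push_cast; ring
  -- 72 = 2·36: at most 6·6 parameters give the same set, and p ≤ 2(p - 1).
  · refine IsBigO.of_bound 72 (eventually_inf_principal.2 ?_)
    filter_upwards [eventually_ge_atTop 100] with p hp hprime
    have : Fact p.Prime := ⟨hprime⟩
    obtain ⟨C, b, hC, h0, h1, hb⟩ := exists_integral_config hab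
    have h := le_ncard_isAbsorbingConfig (p := p) hC h0 h1
      fun u hu w hw i => (hb u hu w hw i).trans_le hp
    have hs : ab.1 * ab.1 ≤ 36 := by
      rcases hab with rfl | rfl | rfl <;> simp
    rw [eabCode, numAbsorbingSets_srCode, Real.norm_of_nonneg (by positivity),
      Real.norm_of_nonneg (by positivity)]
    set N := {S | IsAbsorbingConfig (checkLabel p fun i => (i : ℕ)) ab.1 ab.2 S}.ncard
    have h2 : p ^ 3 ≤ 72 * N := by
      calc p ^ 3 = p * p * p := by ring
        _ ≤ p * p * (2 * (p - 1)) := Nat.mul_le_mul_left _ (by omega)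
        _ = 2 * (p * p * (p - 1)) := by ring
        _ ≤ 2 * (ab.1 * ab.1 * N) := Nat.mul_le_mul_left _ h
        _ ≤ 2 * (36 * N) := Nat.mul_le_mul_left _ (Nat.mul_le_mul_right _ hs)
        _ = 72 * N := by ring
    exact_mod_cast h2
  · refine eventually_inf_principal.2 ?_
    filter_upwards [eventually_gt_atTop 1250] with p hp hprime
    have : Fact p.Prime := ⟨hprime⟩
    have : Fact (1 < p) := ⟨hprime.one_lt⟩
    have hap : ∀ i, selectedRows i < p := fun i =>
      (show selectedRows i < 6 by revert i; decide).trans (by omega)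
    refine ⟨hap, fun ab hab => ?_⟩
    rintro ⟨S, hS⟩
    rw [isAbsorbingSet_iff_config (srCode_ne_zero_iff _)] at hS
    exact not_hasWheel_selectedRows hp S
      (hS.hasWheel (isPartialLinear_checkLabel (by decide) hap) hab)
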